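/- Let $S^2\subset\mathbb{R}^3$ be the unit sphere with its standard area form $\omega_{S^2}$, let $R>0$, and equip $S^2\times S^2$ with the symplectic form $\omega_R=\mathrm{pr}_1^*\omega_{S^2}+R\,\mathrm{pr}_2^*\omega_{S^2}$. For a smooth function $f\colon[-1,1]^2\to\mathbb{R}$ define $\Phi_{R,f}=(J_R,H_f)\colon S^2\times S^2\to\mathbb{R}^2$ by \[ J_R=z_1+Rz_2,\qquad H_f=x_1x_2+y_1y_2+z_1z_2-f(z_1,z_2), \] and put \[ F_{R,f}(z)=-\tfrac12\bigl(f(-Rz,z)+f(Rz,-z)+2Rz^2\bigr)\qquad\text{for all } z\in[-1,1]\text{ with } Rz\in[-1,1]. \] Definitions. Let $(M,\omega)$ be a closed symplectic manifold. The Hamiltonian vector field $X_H$ of $H$ is given by $\iota_{X_H}\omega=-dH$, and $\{F,G\}=\omega(X_F,X_G)$. $\mathrm{Ham}(M,\omega)$ is the set of time-one maps of the isotopies generated by smooth Hamiltonians $H\colon(\mathbb{R}/\mathbb{Z})\times M\to\mathbb{R}$. A set $X\subset M$ is displaceable from $Y\subset M$ if $\varphi(X)\cap\overline{Y}=\emptyset$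 for some $\varphi\in\mathrm{Ham}(M,\omega)$. A closed set $X\subset M$ is a stem if there is a finite-dimensional linear subspace $\mathbb{A}\subset C^\infty(M)$ with $\{F,G\}=0$ for all $F,G\in\mathbb{A}$ such that, for the map $\Phi\colon M\to\mathbb{A}^*$, $\langle\Phi(x),F\rangle=F(x)$, one has $X=\Phi^{-1}(p)$ for some $p\in\Phi(M)$, and every nonempty fiber of $\Phi$ other than $X$ is displaceable from itself. A partial symplectic quasi-state on $(M,\omega)$ is a functional $\zeta\colon C(M)\to\mathbb{R}$ such that (i) $\zeta(a)=a$ for constants $a$; (ii) $\min_M(H_1-H_2)\le\zeta(H_1)-\zeta(H_2)\le\max_M(H_1-H_2)$ for all $H_1,H_2\in C(M)$; (iii) $\zeta(sH)=s\zeta(H)$ for all $H\in C(M)$ and $s>0$; (iv) $\zeta(H\circ\varphi)=\zeta(H)$ for all $H\in C(M)$ and $\varphi\in\mathrm{Ham}(M,\omega)$; (v) $\zeta(H)=0$ for every $H\in C(M)$ whose support is displaceable from itself; (vi) $\zeta(H_1+H_2)\le\zeta(H_1)+\zeta(H_2)$ for all $H_1,H_2\in C^\infty(M)$ with $\{H_1,H_2\}=0$.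 A closed set $X\subset M$ is $\zeta$-superheavy if $\zeta(H)\le\sup_XH$ for all $H\in C(M)$. Theorem. Let $R>0$ and let $f\colon[-1,1]^2\to\mathbb{R}$ be a smooth function such that $F_{R,f}\equiv0$. Then the fiber $\Phi_{R,f}^{-1}(0,0)$ is a stem in $(S^2\times S^2,\omega_R)$; in particular, it is $\zeta$-superheavy for every partial symplectic quasi-state $\zeta$ on $(S^2\times S^2,\omega_R)$. -/

import Mathlib

open Set
open scoped Manifold ContDiff Matrix

noncomputable section

namespace SymplecticQuasiState

section General

variable {E : Type*} [NormedAddCommGroup E] [NormedSpace ℝ E]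
  {H : Type*} [TopologicalSpace H] {I : ModelWithCorners ℝ E H}
  {M : Type*} [TopologicalSpace M] [ChartedSpace H M]

/-- A field of bilinear forms on the tangent spaces of `M`. -/
abbrev BilinField {E : Type*} [NormedAddCommGroup E] [NormedSpace ℝ E]
    {H : Type*} [TopologicalSpace H] (I : ModelWithCorners ℝ E H)
    (M : Type*) [TopologicalSpace M] [ChartedSpace H M] :=
  (x : M) → TangentSpace I x →ₗ[ℝ] TangentSpace I x →ₗ[ℝ] ℝ

/-- The Hamiltonian vector field `X_F` of `F`, i.e. the solution of `σ (X_F, ·) = -dF`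
(it exists and is unique at every point where `σ` is nondegenerate, the tangent spaces being
finite-dimensional). -/
def hamVec (σ : BilinField I M) (F : M → ℝ) (x : M) : TangentSpace I x :=
  Classical.epsilon fun X : TangentSpace I x => ∀ v : TangentSpace I x,
    σ x X v = -mvfderiv I F x v

/-- The Poisson bracket `{F, G} = σ (X_F, X_G)`. -/
def poissonBracket (σ : BilinField I M) (F G : M → ℝ) (x : M) : ℝ :=
  σ x (hamVec σ F x) (hamVec σ G x)

/-- `φ` is a Hamiltonian diffeomorphism: the time-one map of the isotopy `Θ` generated by a smooth
time-dependent Hamiltonian `K` which is `1`-periodic in time, i.e. a smooth function on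
`(ℝ / ℤ) × M`. -/
def IsHamiltonianDiffeo (σ : BilinField I M) (φ : M ≃ₘ⟮I, I⟯ M) : Prop :=
  ∃ K : ℝ → M → ℝ,
    ContMDiff (𝓘(ℝ, ℝ).prod I) 𝓘(ℝ, ℝ) ∞ (fun p : ℝ × M => K p.1 p.2) ∧
    (∀ t x, K (t + 1) x = K t x) ∧
    ∃ Θ : ℝ → M → M,
      (∀ x, Θ 0 x = x) ∧
      (∀ t x, HasMFDerivAt 𝓘(ℝ, ℝ) I (fun s => Θ s x) t
        ((1 : ℝ →L[ℝ] ℝ).smulRight (hamVec σ (K t) (Θ t x)))) ∧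
      ∀ x, Θ 1 x = φ x

/-- `X` is displaceable from `Y`. -/
def Displaceable (σ : BilinField I M) (X Y : Set M) : Prop :=
  ∃ φ : M ≃ₘ⟮I, I⟯ M, IsHamiltonianDiffeo σ φ ∧ φ '' X ∩ closure Y = ∅

/-- Partial symplectic quasi-states on a closed manifold. -/
structure IsPartialSymplecticQuasiState [CompactSpace M] (σ : BilinField I M)
    (ζ : C(M, ℝ) → ℝ) : Prop where
  normalization : ∀ a : ℝ, ζ (ContinuousMap.const M a) = a
  stability_left : ∀ H₁ H₂ : C(M, ℝ), (⨅ x, (H₁ x - H₂ x)) ≤ ζ H₁ - ζ H₂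
  stability_right : ∀ H₁ H₂ : C(M, ℝ), ζ H₁ - ζ H₂ ≤ ⨆ x, (H₁ x - H₂ x)
  semi_homogeneity : ∀ (H₁ : C(M, ℝ)) (s : ℝ), 0 < s → ζ (s • H₁) = s * ζ H₁
  hamiltonian_invariance : ∀ (H₁ : C(M, ℝ)) (φ : M ≃ₘ⟮I, I⟯ M), IsHamiltonianDiffeo σ φ →
    ζ (H₁.comp ⟨φ, φ.continuous⟩) = ζ H₁
  vanishing : ∀ H₁ : C(M, ℝ), Displaceable σ (tsupport H₁) (tsupport H₁) → ζ H₁ = 0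
  quasi_subadditivity : ∀ H₁ H₂ : C^∞⟮I, M; ℝ⟯, (∀ x, poissonBracket σ H₁ H₂ x = 0) →
    ζ ((H₁ + H₂ : C^∞⟮I, M; ℝ⟯) : C(M, ℝ)) ≤ ζ (H₁ : C(M, ℝ)) + ζ (H₂ : C(M, ℝ))

/-- Superheavy closed subsets; the supremum is taken in the extended reals. -/
def IsSuperheavy (ζ : C(M, ℝ) → ℝ) (X : Set M) : Prop :=
  IsClosed X ∧ ∀ H₁ : C(M, ℝ), (ζ H₁ : EReal) ≤ ⨆ x ∈ X, (H₁ x : EReal)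

/-- The moment map `M → 𝔸*` of a subspace `𝔸` of `C^∞(M)`, `⟨Φ(x), F⟩ = F(x)`. -/
def momentMap (A : Submodule ℝ C^∞⟮I, M; ℝ⟯) (x : M) : Module.Dual ℝ A where
  toFun F := (F : C^∞⟮I, M; ℝ⟯) x
  map_add' _ _ := rfl
  map_smul' _ _ := rfl

/-- Stems: a fiber of the moment map of a finite-dimensional Poisson-commutative subspace all of
whose other nonempty fibers are displaceable from themselves. -/
def IsStem (σ : BilinField I M) (X : Set M) : Prop :=
  IsClosed X ∧ ∃ A : Submodule ℝ C^∞⟮I, M; ℝ⟯, FiniteDimensional ℝ A ∧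
    (∀ F ∈ A, ∀ G ∈ A, ∀ x, poissonBracket σ F G x = 0) ∧
    ∃ p ∈ range (momentMap A), X = momentMap A ⁻¹' {p} ∧
      ∀ q ∈ range (momentMap A), momentMap A ⁻¹' {q} ≠ X →
        Displaceable σ (momentMap A ⁻¹' {q}) (momentMap A ⁻¹' {q})

end General

section Spheres

/-- The unit sphere in `ℝ³`, with Mathlib's smooth structure. -/
abbrev S2 : Type := Metric.sphere (0 : EuclideanSpace ℝ (Fin 3)) 1

/-- The differential of the inclusion of `S²` in `ℝ³`. -/
def dIncl (p : S2) : TangentSpace (𝓡 2) p →ₗ[ℝ] (Fin 3 → ℝ) :=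
  (WithLp.linearEquiv 2 ℝ (Fin 3 → ℝ)).toLinearMap ∘ₗ
    (mvfderiv (𝓡 2) (fun q : S2 => (q : EuclideanSpace ℝ (Fin 3))) p).toLinearMap

/-- The standard area form on `S²`: `ω_p (u, v) = p · (u × v)`. -/
def omegaS2 : BilinField (𝓡 2) S2 := fun p =>
  LinearMap.mk₂ ℝ (fun u v => (p : EuclideanSpace ℝ (Fin 3)).ofLp ⬝ᵥ (dIncl p u ⨯₃ dIncl p v))
    (by intros; simp) (by intros; simp) (by intros; simp) (by intros; simp)

theorem omegaS2_apply (p : S2) (u v : TangentSpace (𝓡 2) p) :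
    omegaS2 p u v = (p : EuclideanSpace ℝ (Fin 3)).ofLp ⬝ᵥ (dIncl p u ⨯₃ dIncl p v) := rfl

theorem omegaS2_nondegenerate (p : S2) (u : TangentSpace (𝓡 2) p)
    (h : ∀ v, omegaS2 p u v = 0) : u = 0 := by
  have : Fact (Module.finrank ℝ (EuclideanSpace ℝ (Fin 3)) = 2 + 1) := ⟨by simp⟩
  have hr := range_mvfderiv_subtypeVal (n := 2) p
  have horth : (p : EuclideanSpace ℝ (Fin 3)).ofLp ⬝ᵥ dIncl p u = 0 := by
    have : mvfderiv (𝓡 2) ((↑) : S2 → EuclideanSpace ℝ (Fin 3)) p u ∈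
        (Submodule.span ℝ {(p : EuclideanSpace ℝ (Fin 3))})ᗮ := by
      rw [← hr]; exact ⟨u, rfl⟩
    rw [Submodule.mem_orthogonal_singleton_iff_inner_right] at this
    simpa [dIncl, EuclideanSpace.inner_eq_star_dotProduct, dotProduct_comm] using this
  have hp : (p : EuclideanSpace ℝ (Fin 3)).ofLp ⬝ᵥ (p : EuclideanSpace ℝ (Fin 3)).ofLp = 1 := by
    have h1 : inner ℝ (p : EuclideanSpace ℝ (Fin 3)) (p : EuclideanSpace ℝ (Fin 3)) = 1 := by
      rw [real_inner_self_eq_norm_sq]; simp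
    rw [EuclideanSpace.inner_eq_star_dotProduct] at h1
    simpa only [star_trivial] using h1
  obtain ⟨v, hv⟩ : ∃ v, dIncl p v = (p : EuclideanSpace ℝ (Fin 3)).ofLp ⨯₃ dIncl p u := by
    have : WithLp.toLp 2 ((p : EuclideanSpace ℝ (Fin 3)).ofLp ⨯₃ dIncl p u) ∈
        (mvfderiv (𝓡 2) ((↑) : S2 → EuclideanSpace ℝ (Fin 3)) p).range := by
      rw [hr, Submodule.mem_orthogonal_singleton_iff_inner_right]
      simp [EuclideanSpace.inner_eq_star_dotProduct, dotProduct_comm]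
    obtain ⟨v, hv⟩ := this
    exact ⟨v, congrArg WithLp.ofLp hv⟩
  have h0 : dIncl p u ⬝ᵥ dIncl p u = 0 := by
    have := h v
    rw [omegaS2_apply, hv, triple_product_permutation, triple_product_permutation,
      cross_dot_cross, hp, horth] at this
    simpa [dotProduct_comm _ (dIncl p u), horth] using this
  have h1 : dIncl p u = 0 := dotProduct_self_eq_zero.mp h0
  apply injective_mvfderiv_subtypeVal_sphere (n := 2) p
  rw [map_zero]
  exact congrArg (WithLp.toLp 2) h1

/-- The form `ω_R = pr₁^* ω + R pr₂^* ω` on `S² × S²`. -/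
def omegaR (R : ℝ) : BilinField ((𝓡 2).prod (𝓡 2)) (S2 × S2) := fun p =>
  (omegaS2 p.1).compl₁₂
      (mfderiv ((𝓡 2).prod (𝓡 2)) (𝓡 2) (Prod.fst : S2 × S2 → S2) p).toLinearMap
      (mfderiv ((𝓡 2).prod (𝓡 2)) (𝓡 2) (Prod.fst : S2 × S2 → S2) p).toLinearMap
    + R • (omegaS2 p.2).compl₁₂
      (mfderiv ((𝓡 2).prod (𝓡 2)) (𝓡 2) (Prod.snd : S2 × S2 → S2) p).toLinearMap
      (mfderiv ((𝓡 2).prod (𝓡 2)) (𝓡 2) (Prod.snd : S2 × S2 → S2) p).toLinearMap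

theorem omegaR_apply (R : ℝ) (p : S2 × S2) (u v : TangentSpace ((𝓡 2).prod (𝓡 2)) p) :
    omegaR R p u v = omegaS2 p.1 u.1 v.1 + R * omegaS2 p.2 u.2 v.2 := by
  simp only [omegaR, mfderiv_fst, mfderiv_snd]
  rfl

theorem omegaR_nondegenerate {R : ℝ} (hR : R ≠ 0) (p : S2 × S2)
    (u : TangentSpace ((𝓡 2).prod (𝓡 2)) p) (h : ∀ v, omegaR R p u v = 0) : u = 0 := by
  have h1 : u.1 = 0 := omegaS2_nondegenerate p.1 u.1 fun v => by
    have := (omegaR_apply R p u (v, 0)).symm.trans (h (v, 0))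
    have h0 : omegaS2 p.2 u.2 0 = 0 := map_zero _
    change omegaS2 p.1 u.1 v + R * omegaS2 p.2 u.2 0 = 0 at this
    rwa [h0, mul_zero, add_zero] at this
  have h2 : u.2 = 0 := omegaS2_nondegenerate p.2 u.2 fun v => by
    have := (omegaR_apply R p u (0, v)).symm.trans (h (0, v))
    have h0 : omegaS2 p.1 u.1 0 = 0 := map_zero _
    change omegaS2 p.1 u.1 0 + R * omegaS2 p.2 u.2 v = 0 at this
    rw [h0, zero_add] at this
    exact (mul_eq_zero.mp this).resolve_left hR
  exact Prod.ext h1 h2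

/-- For `ω_R` the defining equation of Hamiltonian vector fields has exactly one solution, so that
`hamVec` is the usual Hamiltonian vector field. -/
theorem hamVec_omegaR_iff {R : ℝ} (hR : R ≠ 0) (F : S2 × S2 → ℝ) (p : S2 × S2)
    (X : TangentSpace ((𝓡 2).prod (𝓡 2)) p) :
    hamVec (omegaR R) F p = X ↔
      ∀ v, omegaR R p X v = -mvfderiv ((𝓡 2).prod (𝓡 2)) F p v := by
  have : FiniteDimensional ℝ (TangentSpace ((𝓡 2).prod (𝓡 2)) p) :=
    inferInstanceAs (FiniteDimensional ℝ (EuclideanSpace ℝ (Fin 2) × EuclideanSpace ℝ (Fin 2)))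
  have hinj : Function.Injective (omegaR R p) := by
    refine (injective_iff_map_eq_zero _).mpr fun u hu => omegaR_nondegenerate hR p u fun v => ?_
    rw [hu]; rfl
  have hsurj : Function.Surjective (omegaR R p) :=
    (LinearMap.injective_iff_surjective_of_finrank_eq_finrank
      (Subspace.dual_finrank_eq (K := ℝ)).symm).mp hinj
  obtain ⟨Y, hY⟩ := hsurj (-(mvfderiv ((𝓡 2).prod (𝓡 2)) F p).toLinearMap)
  have hspec : ∀ v, omegaR R p (hamVec (omegaR R) F p) v =
      -mvfderiv ((𝓡 2).prod (𝓡 2)) F p v :=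
    Classical.epsilon_spec (p := fun X : TangentSpace ((𝓡 2).prod (𝓡 2)) p =>
      ∀ v, omegaR R p X v = -mvfderiv ((𝓡 2).prod (𝓡 2)) F p v)
      ⟨Y, fun v => by rw [hY]; rfl⟩
  constructor
  · rintro rfl; exact hspec
  · intro hX
    exact hinj (LinearMap.ext fun v => by rw [hspec, hX])

/-- `J_R = z₁ + R z₂`. -/
def JR (R : ℝ) (p : S2 × S2) : ℝ := p.1.1 2 + R * p.2.1 2

/-- `H_f = x₁ x₂ + y₁ y₂ + z₁ z₂ - f (z₁, z₂)`. -/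
def Hf (f : ℝ × ℝ → ℝ) (p : S2 × S2) : ℝ :=
  p.1.1 0 * p.2.1 0 + p.1.1 1 * p.2.1 1 + p.1.1 2 * p.2.1 2 - f (p.1.1 2, p.2.1 2)

/-- `Φ_{R,f} = (J_R, H_f)`. -/
def PhiRf (R : ℝ) (f : ℝ × ℝ → ℝ) (p : S2 × S2) : ℝ × ℝ := (JR R p, Hf f p)

/-- `F_{R,f}`. -/
def FRf (R : ℝ) (f : ℝ × ℝ → ℝ) (z : ℝ) : ℝ :=
  -(1 / 2) * (f (-(R * z), z) + f (R * z, -z) + 2 * R * z ^ 2)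

end Spheres

end SymplecticQuasiState

end

open Set
open scoped Manifold ContDiff Matrix

noncomputable section

namespace SymplecticQuasiState

/-! ### Superheaviness of the only fiber not known to be displaceable -/

section Superheavy

variable {E : Type*} [NormedAddCommGroup E] [NormedSpace ℝ E]
  {H : Type*} [TopologicalSpace H] {I : ModelWithCorners ℝ E H}
  {M : Type*} [TopologicalSpace M] [ChartedSpace H M]

/-! Every fiber of `PhiRf R f` off the origin is displaced by half-turns of the two spheres. A
half-turn of both factors about the x-axis negates both heights, hence `J_R`, and so moves every
fiber with nonzero first value. On `J_R = 0`, where `z₁ = -R z₂`, turn the first factor about x and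
the second about y: `x₁x₂` and `y₁y₂` change sign, `z₁z₂` does not, and the sum of the old and new
values of `H_f` is `2 F_{R,f}(z₂) = 0`. So `H_f` changes sign, and a nonzero second value moves too
(`displaceable_PhiRf_fiber`).

Simultaneous half-turns are Hamiltonian, as coordinate functions generate rotations
(`hamVec_axisHam`). The components commute because `H_f` is invariant under the diagonal z-rotation,
the flow of `J_R`.

For superheaviness, a function below `c` on the central fiber is bounded by `c` plus finitely many
bumps pulled back from the base, each with displaceable support. These commute, so `ζ` of the bound
is at most `c`. -/

theorem Displaceable.mono {σ : BilinField I M} {X X' Y Y' : Set M} (h : Displaceable σ X Y)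
    (hX : X' ⊆ X) (hY : Y' ⊆ Y) : Displaceable σ X' Y' := by
  obtain ⟨φ, hφ, h⟩ := h
  exact ⟨φ, hφ, subset_empty_iff.mp
    (h ▸ inter_subset_inter (image_mono hX) (closure_mono hY))⟩

/-- A displaceable fiber of a continuous map on a compact manifold has a displaceable
neighborhood that is a union of fibers. -/
theorem Displaceable.exists_closedBall [CompactSpace M] {V : Type*} [MetricSpace V]
    {σ : BilinField I M} {Φ : M → V} (hΦ : Continuous Φ) {q : V}
    (h : Displaceable σ (Φ ⁻¹' {q}) (Φ ⁻¹' {q})) :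
    ∃ r > 0, Displaceable σ (Φ ⁻¹' Metric.closedBall q r) (Φ ⁻¹' Metric.closedBall q r) := by
  obtain ⟨φ, hφ, h⟩ := h
  have hdisj : ∀ x, Φ x = q → Φ (φ x) ≠ q := fun x hx hx' =>
    eq_empty_iff_forall_notMem.mp h (φ x) ⟨⟨x, hx, rfl⟩, subset_closure hx'⟩
  -- `g` vanishes only if `x` and `φ x` both lie in the fiber, which is excluded. Compactness bounds
  -- it below by some `r > 0`, so the same `φ` displaces the `r`-tube.
  let g : M → ℝ := fun x => max (dist (Φ x) q) (dist (Φ (φ x)) q)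
  have hg : Continuous g :=
    (hΦ.dist continuous_const).max ((hΦ.comp φ.continuous).dist continuous_const)
  have hpos : ∀ x, 0 < g x := fun x => by
    by_cases hx : Φ x = q
    · exact lt_max_of_lt_right (dist_pos.mpr (hdisj x hx))
    · exact lt_max_of_lt_left (dist_pos.mpr hx)
  obtain ⟨r, hr, hrg⟩ : ∃ r > 0, ∀ x, r < g x := by
    rcases isEmpty_or_nonempty M with hM | hM
    · exact ⟨1, one_pos, fun x => hM.elim x⟩
    · obtain ⟨x₀, -, hx₀⟩ := isCompact_univ.exists_isMinOn univ_nonempty hg.continuousOn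
      exact ⟨g x₀ / 2, half_pos (hpos x₀), fun x =>
        (half_lt_self (hpos x₀)).trans_le (hx₀ (mem_univ x))⟩
  refine ⟨r, hr, φ, hφ, eq_empty_iff_forall_notMem.mpr ?_⟩
  rintro _ ⟨⟨x, hx, rfl⟩, hx'⟩
  rw [(Metric.isClosed_closedBall.preimage hΦ).closure_eq] at hx'
  exact (hrg x).not_ge (max_le hx hx')

theorem IsPartialSymplecticQuasiState.mono [CompactSpace M] {σ : BilinField I M}
    {ζ : C(M, ℝ) → ℝ} (hζ : IsPartialSymplecticQuasiState σ ζ) {F G : C(M, ℝ)}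
    (h : ∀ x, F x ≤ G x) : ζ F ≤ ζ G := by
  have := (hζ.stability_right F G).trans (Real.iSup_nonpos fun x => sub_nonpos.mpr (h x))
  linarith

/-- If the pullbacks of smooth functions by `Φ` Poisson commute and all fibers of `Φ` but one are
displaceable, then the remaining fiber is superheavy. -/
theorem IsPartialSymplecticQuasiState.isSuperheavy_fiber [CompactSpace M]
    {V : Type*} [NormedAddCommGroup V] [NormedSpace ℝ V] [FiniteDimensional ℝ V]
    {σ : BilinField I M} {ζ : C(M, ℝ) → ℝ} (hζ : IsPartialSymplecticQuasiState σ ζ)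
    {Φ : M → V} (hΦ : ContMDiff I 𝓘(ℝ, V) ∞ Φ)
    (hcomm : ∀ u v : V → ℝ, ContDiff ℝ ∞ u → ContDiff ℝ ∞ v →
      ∀ x, poissonBracket σ (u ∘ Φ) (v ∘ Φ) x = 0)
    {p : V} (hdisp : ∀ q ≠ p, Displaceable σ (Φ ⁻¹' {q}) (Φ ⁻¹' {q})) :
    IsSuperheavy ζ (Φ ⁻¹' {p}) := by
  refine ⟨isClosed_singleton.preimage hΦ.continuous, fun F => ?_⟩
  -- It suffices to bound `ζ F` by every real `c` above the supremum; an empty fiber, with supremum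
  -- `⊥`, is covered too.
  by_contra! hlt
  obtain ⟨c, hc, hcF⟩ := EReal.lt_iff_exists_real_btwn.mp hlt
  rw [EReal.coe_lt_coe_iff] at hcF
  refine hcF.not_ge ?_
  have hX : ∀ x, Φ x = p → F x < c := fun x hx =>
    EReal.coe_lt_coe_iff.mp ((le_iSup₂ (f := fun x (_ : x ∈ Φ ⁻¹' {p}) => (F x : EReal))
      x hx).trans_lt hc)
  have hr : ∀ q, ∃ r > 0, q ≠ p →
      Displaceable σ (Φ ⁻¹' Metric.closedBall q r) (Φ ⁻¹' Metric.closedBall q r) := fun q => by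
    by_cases hq : q = p
    · exact ⟨1, one_pos, fun h => (h hq).elim⟩
    · obtain ⟨r, hr, h⟩ := (hdisp q hq).exists_closedBall hΦ.continuous
      exact ⟨r, hr, fun _ => h⟩
  choose r hr0 hr using hr
  let ψ (q : V) : ContDiffBump q := ⟨r q / 2, r q, half_pos (hr0 q), half_lt_self (hr0 q)⟩
  obtain ⟨C, hC⟩ : ∃ C, ∀ x, F x - c ≤ C := by
    obtain ⟨C, hC⟩ := (isCompact_range F.continuous).bddAbove
    exact ⟨C - c, fun x => sub_le_sub_right (hC ⟨x, rfl⟩) c⟩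
  let pull (u : V → ℝ) (hu : ContDiff ℝ ∞ u) : C^∞⟮I, M; ℝ⟯ := ⟨u ∘ Φ, hu.contMDiff.comp hΦ⟩
  have hadd : ∀ (u v w : V → ℝ) (hu : ContDiff ℝ ∞ u) (hv : ContDiff ℝ ∞ v)
      (hw : ContDiff ℝ ∞ w), (∀ y, w y = u y + v y) →
      ζ (pull w hw) ≤ ζ (pull u hu) + ζ (pull v hv) := fun u v w hu hv hw h =>
    (hζ.mono (G := ((pull u hu + pull v hv : C^∞⟮I, M; ℝ⟯) : C(M, ℝ))) fun x =>
      (h (Φ x)).le).trans (hζ.quasi_subadditivity _ _ (hcomm u v hu hv))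
  have hbump : ∀ q, ContDiff ℝ ∞ (fun y => |C| * ψ q y) := fun q =>
    contDiff_const.mul (ψ q).contDiff
  have hzero : ∀ q ≠ p, ζ (pull _ (hbump q)) = 0 := fun q hq => by
    refine hζ.vanishing _ ((hr q hq).mono ?_ ?_) <;>
    · refine closure_minimal (fun x hx => ?_)
        (Metric.isClosed_closedBall.preimage hΦ.continuous)
      have : ψ q (Φ x) ≠ 0 := fun h0 => hx (by
        change |C| * ψ q (Φ x) = 0
        rw [h0, mul_zero])
      have : Φ x ∈ Function.support (ψ q) := this
      rw [(ψ q).support_eq] at this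
      exact Metric.ball_subset_closedBall this
  -- Each bump away from `p` has `ζ`-value zero, so adding one does not raise the bound.
  have hsum : ∀ s : Finset V, (∀ q ∈ s, q ≠ p) →
      ∃ hu : ContDiff ℝ ∞ (fun y => c + ∑ q ∈ s, |C| * ψ q y), ζ (pull _ hu) ≤ c := by
    classical
    intro s
    induction s using Finset.induction_on with
    | empty =>
      intro _
      refine ⟨by simpa using contDiff_const, ?_⟩
      refine (hζ.mono fun x => ?_).trans (hζ.normalization c).le
      change c + ∑ q ∈ ∅, |C| * ψ q (Φ x) ≤ c
      simp
    | insert a s ha ih =>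
      intro hs
      obtain ⟨hu, hle⟩ := ih fun q hq => hs q (Finset.mem_insert_of_mem hq)
      have heq : ∀ y, c + ∑ q ∈ insert a s, |C| * ψ q y =
          (c + ∑ q ∈ s, |C| * ψ q y) + |C| * ψ a y := fun y => by
        rw [Finset.sum_insert ha]; ring
      refine ⟨by simpa only [heq] using hu.add (hbump a), ?_⟩
      have := hadd _ _ _ hu (hbump a) (by simpa only [heq] using hu.add (hbump a)) heq
      rw [hzero a (hs a (Finset.mem_insert_self a s)), add_zero] at this
      exact this.trans hle
  -- The radius is halved because the bump at `q` equals 1 on the ball of radius `r q / 2`. The set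
  -- `{c ≤ F}` misses the fiber over `p`, so every centre used differs from `p`.
  obtain ⟨s, hs, hcov⟩ := ((isClosed_le continuous_const F.continuous).isCompact :
      IsCompact {x | c ≤ F x}).elim_nhds_subcover
    (fun x => Φ ⁻¹' Metric.ball (Φ x) (r (Φ x) / 2)) fun x _ =>
      hΦ.continuous.continuousAt (Metric.ball_mem_nhds _ (half_pos (hr0 _)))
  classical
  obtain ⟨hu, hle⟩ := hsum (s.image Φ) fun q hq => by
    obtain ⟨x, hx, rfl⟩ := Finset.mem_image.mp hq
    exact fun h => (hX x h).not_ge (hs x hx)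
  refine (hζ.mono fun x => ?_).trans hle
  change F x ≤ c + ∑ q ∈ s.image Φ, |C| * ψ q (Φ x)
  have hnn : ∀ q ∈ s.image Φ, 0 ≤ |C| * ψ q (Φ x) := fun q _ =>
    mul_nonneg (abs_nonneg C) (ψ q).nonneg
  by_cases hx : c ≤ F x
  · obtain ⟨y, hy, hxy⟩ := mem_iUnion₂.mp (hcov hx)
    have h1 : ψ (Φ y) (Φ x) = 1 := (ψ (Φ y)).one_of_mem_closedBall
      (Metric.ball_subset_closedBall hxy)
    have := Finset.single_le_sum hnn (Finset.mem_image_of_mem Φ hy)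
    rw [h1, mul_one] at this
    linarith [hC x, le_abs_self C]
  · linarith [Finset.sum_nonneg hnn]

end Superheavy

/-! ### Rotations of the sphere and their velocities -/

section Rotations

/-- The rotation of `ℝ³` by the angle `-t` around the `i`-th coordinate axis. -/
def rotVec (i : Fin 3) (t : ℝ) (v : EuclideanSpace ℝ (Fin 3)) : EuclideanSpace ℝ (Fin 3) :=
  WithLp.toLp 2 fun j => if j = i then v i
    else if j = i + 1 then Real.cos t * v (i + 1) + Real.sin t * v (i + 2)
    else -Real.sin t * v (i + 1) + Real.cos t * v (i + 2)

theorem rotVec_apply (i : Fin 3) (t : ℝ) (v : EuclideanSpace ℝ (Fin 3)) (j : Fin 3) :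
    rotVec i t v j = if j = i then v i
      else if j = i + 1 then Real.cos t * v (i + 1) + Real.sin t * v (i + 2)
      else -Real.sin t * v (i + 1) + Real.cos t * v (i + 2) := rfl

theorem norm_rotVec (i : Fin 3) (t : ℝ) (v : EuclideanSpace ℝ (Fin 3)) :
    ‖rotVec i t v‖ = ‖v‖ := by
  rw [EuclideanSpace.norm_eq, EuclideanSpace.norm_eq]
  congr 1
  simp only [Real.norm_eq_abs, sq_abs, Fin.sum_univ_three, rotVec_apply]
  have := Real.sin_sq_add_cos_sq t
  fin_cases i <;> simp <;> grind

theorem rotVec_zero (i : Fin 3) (v : EuclideanSpace ℝ (Fin 3)) : rotVec i 0 v = v := by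
  ext j
  rw [rotVec_apply]
  fin_cases i <;> fin_cases j <;> simp

theorem rotVec_neg_rotVec (i : Fin 3) (t : ℝ) (v : EuclideanSpace ℝ (Fin 3)) :
    rotVec i (-t) (rotVec i t v) = v := by
  ext j
  simp only [rotVec_apply]
  have := Real.sin_sq_add_cos_sq t
  fin_cases i <;> fin_cases j <;> simp <;> grind

theorem contDiff_rotVec (i : Fin 3) :
    ContDiff ℝ ∞ fun q : ℝ × EuclideanSpace ℝ (Fin 3) => rotVec i q.1 q.2 := by
  rw [contDiff_euclidean]
  intro j
  simp only [rotVec_apply]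
  split_ifs <;> fun_prop

theorem hasDerivAt_rotVec (i : Fin 3) (c t : ℝ) (v : EuclideanSpace ℝ (Fin 3)) :
    HasDerivAt (fun s => rotVec i (c * s) v)
      (WithLp.toLp 2 (c • ((rotVec i (c * t) v).ofLp ⨯₃ Pi.single i 1))) t := by
  rw [hasDerivAt_iff_hasFDerivAt, ← hasFDerivWithinAt_univ, hasFDerivWithinAt_euclidean]
  intro j
  have hs : HasDerivAt (fun s : ℝ => c * s) c t := by simpa using (hasDerivAt_id t).const_mul c
  have hsin := hs.sin
  have hcos := hs.cos
  suffices HasDerivAt (fun s => rotVec i (c * s) v j)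
      ((c • ((rotVec i (c * t) v).ofLp ⨯₃ Pi.single i 1)) j) t by
    rw [hasFDerivWithinAt_univ]
    exact this.hasFDerivAt.congr_fderiv (by ext; simp)
  simp only [rotVec_apply]
  split_ifs with h1 h2
  · refine (hasDerivAt_const t (v i)).congr_deriv ?_
    subst h1
    fin_cases j <;> simp [cross_apply, rotVec_apply]
  · refine ((hcos.mul_const (v (i + 1))).add (hsin.mul_const (v (i + 2)))).congr_deriv ?_
    subst h2
    fin_cases i <;> simp [cross_apply, rotVec_apply] <;> ring
  · refine ((hsin.neg.mul_const (v (i + 1))).add (hcos.mul_const (v (i + 2)))).congr_deriv ?_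
    have h3 : j = i + 2 := by revert h1 h2; revert i j; decide
    subst h3
    fin_cases i <;> simp [cross_apply, rotVec_apply] <;> ring

/-- The rotation of `S²` by the angle `-t` around the `i`-th coordinate axis. -/
def rot (i : Fin 3) (t : ℝ) : S2 → S2 :=
  codRestrict (fun p : S2 => rotVec i t p) _ fun p => by
    rw [mem_sphere_zero_iff_norm, norm_rotVec, norm_eq_of_mem_sphere]

theorem coe_rot (i : Fin 3) (t : ℝ) (p : S2) :
    (rot i t p : EuclideanSpace ℝ (Fin 3)) = rotVec i t p := rfl

theorem contMDiff_coe_S2 :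
    ContMDiff (𝓡 2) 𝓘(ℝ, EuclideanSpace ℝ (Fin 3)) ∞
      (fun q : S2 => (q : EuclideanSpace ℝ (Fin 3))) := by
  have : Fact (Module.finrank ℝ (EuclideanSpace ℝ (Fin 3)) = 2 + 1) := ⟨by simp⟩
  exact contMDiff_coe_sphere (n := 2)

theorem contMDiff_S2_of_coe {E : Type*} [NormedAddCommGroup E] [NormedSpace ℝ E]
    {H : Type*} [TopologicalSpace H] {I : ModelWithCorners ℝ E H}
    {M : Type*} [TopologicalSpace M] [ChartedSpace H M]
    [IsManifold I ∞ M] {g : M → S2}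
    (hg : ContMDiff I 𝓘(ℝ, EuclideanSpace ℝ (Fin 3)) ∞
      (fun x => (g x : EuclideanSpace ℝ (Fin 3)))) : ContMDiff I (𝓡 2) ∞ g := by
  have : Fact (Module.finrank ℝ (EuclideanSpace ℝ (Fin 3)) = 2 + 1) := ⟨by simp⟩
  exact hg.codRestrict_sphere (n := 2) fun x => (g x).2

theorem contMDiff_rot (i : Fin 3) (t : ℝ) : ContMDiff (𝓡 2) (𝓡 2) ∞ (rot i t) :=
  contMDiff_S2_of_coe (((contDiff_rotVec i).comp (contDiff_prodMk_right t)).contMDiff.comp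
    contMDiff_coe_S2)

/-- The rotation around the `i`-th coordinate axis as a diffeomorphism of `S²`. -/
def rotDiffeo (i : Fin 3) (t : ℝ) : S2 ≃ₘ⟮𝓡 2, 𝓡 2⟯ S2 where
  toFun := rot i t
  invFun := rot i (-t)
  left_inv p := Subtype.ext (rotVec_neg_rotVec i t p)
  right_inv p := Subtype.ext (by
    simpa only [neg_neg, coe_rot] using rotVec_neg_rotVec i (-t) p)
  contMDiff_toFun := contMDiff_rot i t
  contMDiff_invFun := contMDiff_rot i (-t)

theorem hasMFDerivAt_coe (p : S2) :
    HasMFDerivAt (𝓡 2) 𝓘(ℝ, EuclideanSpace ℝ (Fin 3))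
      (fun q : S2 => (q : EuclideanSpace ℝ (Fin 3))) p
      (mvfderiv (𝓡 2) (fun q : S2 => (q : EuclideanSpace ℝ (Fin 3))) p) :=
  ((contMDiff_coe_S2 p).mdifferentiableAt (by simp)).hasMFDerivAt

/-- The velocity of a rotating point. -/
theorem exists_hasMFDerivAt_rot (i : Fin 3) (c t : ℝ) (p : S2) :
    ∃ w : TangentSpace (𝓡 2) (rot i (c * t) p),
      HasMFDerivAt 𝓘(ℝ, ℝ) (𝓡 2) (fun s => rot i (c * s) p) t
        ((1 : ℝ →L[ℝ] ℝ).smulRight w) ∧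
      dIncl _ w = c • ((rot i (c * t) p : EuclideanSpace ℝ (Fin 3)).ofLp ⨯₃ Pi.single i 1) := by
  have hsm : ContMDiff 𝓘(ℝ, ℝ) (𝓡 2) ∞ (fun s => rot i (c * s) p) :=
    contMDiff_S2_of_coe ((contDiff_rotVec i).comp
      ((contDiff_const.mul contDiff_id).prodMk contDiff_const)).contMDiff
  have hd := ((hsm t).mdifferentiableAt (by simp)).hasMFDerivAt
  -- The velocity is the derivative applied to 1; composing with the inclusion reduces its value to
  -- the computation in `ℝ³`.
  refine ⟨mfderiv 𝓘(ℝ, ℝ) (𝓡 2) (fun s => rot i (c * s) p) t (1 : ℝ), ?_, ?_⟩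
  · refine hd.congr_mfderiv (ContinuousLinearMap.ext fun x => ?_)
    set D := mfderiv 𝓘(ℝ, ℝ) (𝓡 2) (fun s => rot i (c * s) p) t
    exact (congrArg D (@mul_one ℝ _ x)).symm.trans (D.map_smul (x : ℝ) (1 : ℝ))
  · have h1 := (hasMFDerivAt_coe (rot i (c * t) p)).comp t hd
    have h2 := hasMFDerivAt_unique h1 (hasDerivAt_rotVec i c t p).hasFDerivAt.hasMFDerivAt
    have h3 := congrArg WithLp.ofLp (DFunLike.congr_fun h2 (1 : ℝ))
    refine Eq.trans h3 ?_
    exact congrArg WithLp.ofLp (one_smul ℝ _)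

end Rotations

/-! ### Rotations as Hamiltonian flows -/

section RotationFlows

theorem coe_dotProduct_self (p : S2) :
    (p : EuclideanSpace ℝ (Fin 3)).ofLp ⬝ᵥ (p : EuclideanSpace ℝ (Fin 3)).ofLp = 1 := by
  have h : inner ℝ (p : EuclideanSpace ℝ (Fin 3)) (p : EuclideanSpace ℝ (Fin 3)) = 1 := by
    rw [real_inner_self_eq_norm_sq]; simp
  rw [EuclideanSpace.inner_eq_star_dotProduct] at h
  simpa only [star_trivial] using h

theorem coe_dotProduct_dIncl (p : S2) (u : TangentSpace (𝓡 2) p) :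
    (p : EuclideanSpace ℝ (Fin 3)).ofLp ⬝ᵥ dIncl p u = 0 := by
  have : Fact (Module.finrank ℝ (EuclideanSpace ℝ (Fin 3)) = 2 + 1) := ⟨by simp⟩
  have h : mvfderiv (𝓡 2) ((↑) : S2 → EuclideanSpace ℝ (Fin 3)) p u ∈
      (Submodule.span ℝ {(p : EuclideanSpace ℝ (Fin 3))})ᗮ := by
    rw [← range_mvfderiv_subtypeVal (n := 2) p]; exact ⟨u, rfl⟩
  rw [Submodule.mem_orthogonal_singleton_iff_inner_right] at h
  simpa [dIncl, EuclideanSpace.inner_eq_star_dotProduct, dotProduct_comm] using h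

/-- Since `p · p = 1` and `p · v = 0`, the identity `p · ((p × e) × v) = (p · v)(e · p) - (p · p)(e
· v)` leaves `-(e · v)`. Thus `c (p × eᵢ)` is the Hamiltonian field of `c` times the `i`-th
coordinate. -/
theorem omegaS2_of_dIncl_eq (p : S2) (i : Fin 3) (c : ℝ) {u : TangentSpace (𝓡 2) p}
    (hu : dIncl p u = c • ((p : EuclideanSpace ℝ (Fin 3)).ofLp ⨯₃ Pi.single i 1))
    (v : TangentSpace (𝓡 2) p) : omegaS2 p u v = -(c * dIncl p v i) := by
  rw [omegaS2_apply, hu, map_smul, LinearMap.smul_apply, dotProduct_smul,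
    triple_product_permutation, cross_dot_cross,
    coe_dotProduct_self, coe_dotProduct_dIncl]
  simp

/-- The Hamiltonian whose flow rotates the factors of `S² × S²` around the coordinate axes `i` and
`j` with angular velocity `-c`. -/
def axisHam (R c : ℝ) (i j : Fin 3) (p : S2 × S2) : ℝ := c * (p.1.1 i + R * p.2.1 j)

theorem hasMFDerivAt_coord (i : Fin 3) (p : S2) :
    HasMFDerivAt (𝓡 2) 𝓘(ℝ, ℝ) (fun q : S2 => (q : EuclideanSpace ℝ (Fin 3)) i) p
      ((EuclideanSpace.proj i : EuclideanSpace ℝ (Fin 3) →L[ℝ] ℝ) ∘L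
        mvfderiv (𝓡 2) (fun q : S2 => (q : EuclideanSpace ℝ (Fin 3))) p) :=
  (EuclideanSpace.proj i : EuclideanSpace ℝ (Fin 3) →L[ℝ] ℝ).hasMFDerivAt.comp p
    (hasMFDerivAt_coe p)

theorem contMDiff_coord (i : Fin 3) :
    ContMDiff (𝓡 2) 𝓘(ℝ, ℝ) ∞ (fun q : S2 => (q : EuclideanSpace ℝ (Fin 3)) i) :=
  (EuclideanSpace.proj i : EuclideanSpace ℝ (Fin 3) →L[ℝ] ℝ).contDiff.contMDiff.comp
    contMDiff_coe_S2

theorem contMDiff_axisHam (R c : ℝ) (i j : Fin 3) :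
    ContMDiff ((𝓡 2).prod (𝓡 2)) 𝓘(ℝ, ℝ) ∞ (axisHam R c i j) :=
  contMDiff_const.mul (((contMDiff_coord i).comp contMDiff_fst).add
    (contMDiff_const.mul ((contMDiff_coord j).comp contMDiff_snd)))

theorem mvfderiv_axisHam (R c : ℝ) (i j : Fin 3) (p : S2 × S2)
    (v : TangentSpace ((𝓡 2).prod (𝓡 2)) p) :
    mvfderiv ((𝓡 2).prod (𝓡 2)) (axisHam R c i j) p v =
      c * (dIncl p.1 v.1 i + R * dIncl p.2 v.2 j) := by
  have h1 := (hasMFDerivAt_coord i p.1).comp p (hasMFDerivAt_fst (I := 𝓡 2) (I' := 𝓡 2) p)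
  have h2 := (hasMFDerivAt_coord j p.2).comp p (hasMFDerivAt_snd (I := 𝓡 2) (I' := 𝓡 2) p)
  have h := (h1.add (h2.const_smul R)).const_smul c
  exact DFunLike.congr_fun h.mfderiv v

/-- The weight `R` in `axisHam` matches the weight of the second area form, so both factors turn at
the same speed. -/
theorem hamVec_axisHam {R : ℝ} (hR : R ≠ 0) (c : ℝ) (i j : Fin 3) (p : S2 × S2)
    {w : TangentSpace ((𝓡 2).prod (𝓡 2)) p}
    (h1 : dIncl p.1 w.1 = c • ((p.1 : EuclideanSpace ℝ (Fin 3)).ofLp ⨯₃ Pi.single i 1))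
    (h2 : dIncl p.2 w.2 = c • ((p.2 : EuclideanSpace ℝ (Fin 3)).ofLp ⨯₃ Pi.single j 1)) :
    hamVec (omegaR R) (axisHam R c i j) p = w := by
  rw [hamVec_omegaR_iff hR]
  intro v
  rw [mvfderiv_axisHam]
  refine (omegaR_apply R p w v).trans ((congrArg₂ (fun a b => a + R * b)
    (omegaS2_of_dIncl_eq p.1 i c h1 v.1) (omegaS2_of_dIncl_eq p.2 j c h2 v.2)).trans ?_)
  ring

/-- The rotations of the factors form the flow of `axisHam`. -/
theorem hasMFDerivAt_rot_prod {R : ℝ} (hR : R ≠ 0) (c : ℝ) (i j : Fin 3) (p : S2 × S2) (t : ℝ) :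
    HasMFDerivAt 𝓘(ℝ, ℝ) ((𝓡 2).prod (𝓡 2)) (fun s => (rot i (c * s) p.1, rot j (c * s) p.2)) t
      ((1 : ℝ →L[ℝ] ℝ).smulRight
        (hamVec (omegaR R) (axisHam R c i j) (rot i (c * t) p.1, rot j (c * t) p.2))) := by
  obtain ⟨w₁, hw₁, h₁⟩ := exists_hasMFDerivAt_rot i c t p.1
  obtain ⟨w₂, hw₂, h₂⟩ := exists_hasMFDerivAt_rot j c t p.2
  have hw := hamVec_axisHam hR c i j (rot i (c * t) p.1, rot j (c * t) p.2) (w := (w₁, w₂)) h₁ h₂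
  rw [hw]
  exact hw₁.prodMk hw₂

theorem isHamiltonianDiffeo_rot_prod {R : ℝ} (hR : R ≠ 0) (c : ℝ) (i j : Fin 3) :
    IsHamiltonianDiffeo (omegaR R) ((rotDiffeo i c).prodCongr (rotDiffeo j c)) := by
  refine ⟨fun _ => axisHam R c i j, (contMDiff_axisHam R c i j).comp contMDiff_snd,
    fun _ _ => rfl, fun s p => (rot i (c * s) p.1, rot j (c * s) p.2), fun p => ?_,
    fun t p => hasMFDerivAt_rot_prod hR c i j p t, fun p => ?_⟩
  · refine Prod.ext (Subtype.ext ?_) (Subtype.ext ?_) <;>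
    simp only [mul_zero, coe_rot, rotVec_zero]
  · simp only [mul_one]; rfl

theorem rot_pi_apply (i j : Fin 3) (p : S2) :
    (rot i Real.pi p).1 j = if j = i then p.1 j else -p.1 j := by
  rw [coe_rot, rotVec_apply]
  fin_cases i <;> fin_cases j <;> simp

end RotationFlows

/-! ### Commutation and displacement for the system `(J_R, H_f)` -/

section Fibers

theorem coord_mem_Icc (p : S2) (i : Fin 3) : p.1 i ∈ Icc (-1 : ℝ) 1 := by
  have := PiLp.norm_apply_le (p : EuclideanSpace ℝ (Fin 3)) i
  rw [norm_eq_of_mem_sphere, Real.norm_eq_abs] at this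
  exact abs_le.mp this

theorem JR_eq_axisHam (R : ℝ) : JR R = axisHam R 1 2 2 := by
  ext p; simp [JR, axisHam]

theorem contMDiff_JR (R : ℝ) : ContMDiff ((𝓡 2).prod (𝓡 2)) 𝓘(ℝ, ℝ) ∞ (JR R) :=
  JR_eq_axisHam R ▸ contMDiff_axisHam R 1 2 2

theorem contMDiff_Hf {f : ℝ × ℝ → ℝ}
    (hf : ContDiffOn ℝ ∞ f (Icc (-1) 1 ×ˢ Icc (-1) 1)) :
    ContMDiff ((𝓡 2).prod (𝓡 2)) 𝓘(ℝ, ℝ) ∞ (Hf f) := by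
  have h1 (i : Fin 3) : ContMDiff ((𝓡 2).prod (𝓡 2)) 𝓘(ℝ, ℝ) ∞ (fun p : S2 × S2 => p.1.1 i) :=
    (contMDiff_coord i).comp contMDiff_fst
  have h2 (i : Fin 3) : ContMDiff ((𝓡 2).prod (𝓡 2)) 𝓘(ℝ, ℝ) ∞ (fun p : S2 × S2 => p.2.1 i) :=
    (contMDiff_coord i).comp contMDiff_snd
  have h3 : ContMDiff ((𝓡 2).prod (𝓡 2)) 𝓘(ℝ, ℝ) ∞
      (fun p : S2 × S2 => f (p.1.1 2, p.2.1 2)) :=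
    hf.contMDiffOn.comp_contMDiff ((h1 2).prodMk_space (h2 2)) fun p =>
      ⟨coord_mem_Icc p.1 2, coord_mem_Icc p.2 2⟩
  exact ((((h1 0).mul (h2 0)).add ((h1 1).mul (h2 1))).add ((h1 2).mul (h2 2))).sub h3

/-- The inner product of the two points and both heights are invariant under a common rotation about
the z-axis. -/
theorem Hf_rot (f : ℝ × ℝ → ℝ) (t : ℝ) (p : S2 × S2) :
    Hf f (rot 2 t p.1, rot 2 t p.2) = Hf f p := by
  have := Real.sin_sq_add_cos_sq t
  simp only [Hf, coe_rot, rotVec_apply]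
  simp
  grind

theorem mvfderiv_hamVec_omegaR {R : ℝ} (hR : R ≠ 0) (F G : S2 × S2 → ℝ) (p : S2 × S2) :
    mvfderiv ((𝓡 2).prod (𝓡 2)) F p (hamVec (omegaR R) G p) = -poissonBracket (omegaR R) F G p := by
  rw [poissonBracket, (hamVec_omegaR_iff hR F p _).mp rfl, neg_neg]

theorem omegaS2_swap (p : S2) (u v : TangentSpace (𝓡 2) p) :
    omegaS2 p u v = -omegaS2 p v u := by
  rw [omegaS2_apply, omegaS2_apply, ← cross_anticomm, dotProduct_neg]

theorem omegaR_swap (R : ℝ) (p : S2 × S2) (u v : TangentSpace ((𝓡 2).prod (𝓡 2)) p) :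
    omegaR R p u v = -omegaR R p v u := by
  rw [omegaR_apply R p v u]
  refine (omegaR_apply R p u v).trans ((congrArg₂ (fun a b => a + R * b)
    (omegaS2_swap p.1 u.1 v.1) (omegaS2_swap p.2 u.2 v.2)).trans ?_)
  ring

theorem poissonBracket_omegaR_swap (R : ℝ) (F G : S2 × S2 → ℝ) (p : S2 × S2) :
    poissonBracket (omegaR R) F G p = -poissonBracket (omegaR R) G F p :=
  omegaR_swap R p _ _

/-- Up to sign, the bracket is the derivative at time 0 of `H_f` along the flow of `J_R`, on which
`H_f` is constant. -/
theorem poissonBracket_Hf_JR {R : ℝ} (hR : R ≠ 0) {f : ℝ × ℝ → ℝ}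
    (hf : ContDiffOn ℝ ∞ f (Icc (-1) 1 ×ˢ Icc (-1) 1)) (p : S2 × S2) :
    poissonBracket (omegaR R) (Hf f) (JR R) p = 0 := by
  have hγ := hasMFDerivAt_rot_prod hR 1 2 2 p 0
  have hH := ((contMDiff_Hf hf (rot 2 (1 * 0) p.1, rot 2 (1 * 0) p.2)).mdifferentiableAt
    (by simp)).hasMFDerivAt
  have hc := hH.comp (0 : ℝ) hγ
  have hconst : Hf f ∘ (fun s : ℝ => (rot 2 (1 * s) p.1, rot 2 (1 * s) p.2)) =
      fun _ => Hf f p := funext fun s => Hf_rot f _ p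
  rw [hconst] at hc
  have h0 := DFunLike.congr_fun (hasMFDerivAt_unique hc (hasMFDerivAt_const (Hf f p) (0 : ℝ)))
    (1 : ℝ)
  have h1 : mvfderiv ((𝓡 2).prod (𝓡 2)) (Hf f) (rot 2 (1 * 0) p.1, rot 2 (1 * 0) p.2)
      ((1 : ℝ) • hamVec (omegaR R) (axisHam R 1 2 2) (rot 2 (1 * 0) p.1, rot 2 (1 * 0) p.2)) = 0 :=
    h0
  have hp : ((rot 2 (1 * 0) p.1, rot 2 (1 * 0) p.2) : S2 × S2) = p := by
    refine Prod.ext (Subtype.ext ?_) (Subtype.ext ?_) <;>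
    simp only [mul_zero, coe_rot, rotVec_zero]
  rw [hp, one_smul, ← JR_eq_axisHam, mvfderiv_hamVec_omegaR hR] at h1
  exact neg_eq_zero.mp h1

theorem contMDiff_PhiRf (R : ℝ) {f : ℝ × ℝ → ℝ}
    (hf : ContDiffOn ℝ ∞ f (Icc (-1) 1 ×ˢ Icc (-1) 1)) :
    ContMDiff ((𝓡 2).prod (𝓡 2)) 𝓘(ℝ, ℝ × ℝ) ∞ (PhiRf R f) :=
  (contMDiff_JR R).prodMk_space (contMDiff_Hf hf)

theorem mvfderiv_comp_PhiRf (R : ℝ) {f : ℝ × ℝ → ℝ}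
    (hf : ContDiffOn ℝ ∞ f (Icc (-1) 1 ×ˢ Icc (-1) 1)) {u : ℝ × ℝ → ℝ} (hu : ContDiff ℝ ∞ u)
    (p : S2 × S2) (v : TangentSpace ((𝓡 2).prod (𝓡 2)) p) :
    mvfderiv ((𝓡 2).prod (𝓡 2)) (u ∘ PhiRf R f) p v =
      fderiv ℝ u (PhiRf R f p) (mvfderiv ((𝓡 2).prod (𝓡 2)) (JR R) p v,
        mvfderiv ((𝓡 2).prod (𝓡 2)) (Hf f) p v) := by
  have hJ := ((contMDiff_JR R p).mdifferentiableAt (by simp)).hasMFDerivAt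
  have hH := ((contMDiff_Hf hf p).mdifferentiableAt (by simp)).hasMFDerivAt
  have hΦ : HasMFDerivAt ((𝓡 2).prod (𝓡 2)) 𝓘(ℝ, ℝ × ℝ) (PhiRf R f) p
      ((mvfderiv ((𝓡 2).prod (𝓡 2)) (JR R) p).prod (mvfderiv ((𝓡 2).prod (𝓡 2)) (Hf f) p)) :=
    ⟨hJ.1.prodMk hH.1, hJ.2.prodMk hH.2⟩
  have h := ((hu.differentiable (by simp)) (PhiRf R f p)).hasFDerivAt.hasMFDerivAt.comp p hΦ
  exact DFunLike.congr_fun h.mfderiv v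

/-- Functions of `(J_R, H_f)` Poisson commute. -/
theorem poissonBracket_comp_PhiRf {R : ℝ} (hR : R ≠ 0) {f : ℝ × ℝ → ℝ}
    (hf : ContDiffOn ℝ ∞ f (Icc (-1) 1 ×ˢ Icc (-1) 1)) {u v : ℝ × ℝ → ℝ} (hu : ContDiff ℝ ∞ u)
    (hv : ContDiff ℝ ∞ v) (p : S2 × S2) :
    poissonBracket (omegaR R) (u ∘ PhiRf R f) (v ∘ PhiRf R f) p = 0 := by
  have hHJ := poissonBracket_Hf_JR hR hf p
  have hJH : poissonBracket (omegaR R) (JR R) (Hf f) p = 0 := by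
    rw [poissonBracket_omegaR_swap, hHJ, neg_zero]
  have hself : ∀ F, poissonBracket (omegaR R) F F p = 0 := fun F => by
    linarith [poissonBracket_omegaR_swap R F F p]
  -- Chain rule in the first slot; antisymmetry then lets it serve for both slots.
  have key : ∀ {w : ℝ × ℝ → ℝ}, ContDiff ℝ ∞ w → ∀ G : S2 × S2 → ℝ,
      poissonBracket (omegaR R) (JR R) G p = 0 → poissonBracket (omegaR R) (Hf f) G p = 0 →
      poissonBracket (omegaR R) (w ∘ PhiRf R f) G p = 0 := fun hw G h1 h2 => by
    have := mvfderiv_comp_PhiRf R hf hw p (hamVec (omegaR R) G p)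
    rw [mvfderiv_hamVec_omegaR hR, mvfderiv_hamVec_omegaR hR, mvfderiv_hamVec_omegaR hR, h1, h2,
      neg_zero, ← Prod.zero_eq_mk, map_zero] at this
    exact neg_eq_zero.mp this
  refine key hu _ ?_ ?_ <;> rw [poissonBracket_omegaR_swap, neg_eq_zero]
  · exact key hv _ (hself _) hHJ
  · exact key hv _ hJH (hself _)

/-- Every fiber of `Φ_{R,f}` but the one over the origin is displaced by a pair of rotations by
the angle `π`. -/
theorem displaceable_PhiRf_fiber {R : ℝ} (hR : R ≠ 0) {f : ℝ × ℝ → ℝ}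
    (hf : ContDiffOn ℝ ∞ f (Icc (-1) 1 ×ˢ Icc (-1) 1))
    (hF : ∀ z ∈ Icc (-1 : ℝ) 1, R * z ∈ Icc (-1 : ℝ) 1 → FRf R f z = 0)
    (q : ℝ × ℝ) (hq : q ≠ (0, 0)) :
    Displaceable (omegaR R) (PhiRf R f ⁻¹' {q}) (PhiRf R f ⁻¹' {q}) := by
  suffices ∃ j : Fin 3, ∀ p : S2 × S2, PhiRf R f p = q →
      PhiRf R f (rot 0 Real.pi p.1, rot j Real.pi p.2) ≠ q by
    obtain ⟨j, hj⟩ := this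
    refine ⟨_, isHamiltonianDiffeo_rot_prod hR Real.pi 0 j, eq_empty_iff_forall_notMem.mpr ?_⟩
    rintro _ ⟨⟨p, hp, rfl⟩, hp'⟩
    rw [(isClosed_singleton.preimage (contMDiff_PhiRf R hf).continuous).closure_eq] at hp'
    exact hj p hp hp'
  by_cases h0 : q.1 = 0
  · have h1 : q.2 ≠ 0 := fun h1 => hq (Prod.ext h0 h1)
    -- Axes x and y: on `J_R = 0` this pair of half-turns negates `H_f`, by the vanishing of
    -- `F_{R,f}`.
    refine ⟨1, ?_⟩
    rintro p rfl hp
    have hJ : p.1.1 2 = -(R * p.2.1 2) := eq_neg_of_add_eq_zero_left h0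
    have hz : R * p.2.1 2 ∈ Icc (-1 : ℝ) 1 := by
      have := coord_mem_Icc p.1 2
      rw [hJ] at this
      exact ⟨by linarith [this.2], by linarith [this.1]⟩
    have hFz := hF _ (coord_mem_Icc p.2 2) hz
    have hH := congrArg Prod.snd hp
    simp only [PhiRf, Hf, rot_pi_apply, FRf] at hH hFz h1
    simp [hJ] at hH hFz h1
    exact h1 (by linear_combination (-1 / 2) * hH - (1 / 2) * hFz)
  -- Both axes x: the half-turns negate `J_R`.
  · refine ⟨0, ?_⟩
    rintro p rfl hp
    have hJ := congrArg Prod.fst hp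
    simp only [PhiRf, JR, rot_pi_apply] at hJ h0
    simp at hJ
    exact h0 (by linarith)

/-- A stem must lie over a point of the image. As `F_{R,f}(0) = -f(0,0)`, two orthogonal horizontal
vectors map to the origin. -/
theorem PhiRf_fiber_nonempty {R : ℝ} {f : ℝ × ℝ → ℝ} (hF : FRf R f 0 = 0) :
    (PhiRf R f ⁻¹' {(0, 0)}).Nonempty := by
  have hf0 : f (0, 0) = 0 := by
    simp [FRf] at hF
    linarith
  refine ⟨(⟨EuclideanSpace.single 0 1, by simp⟩, ⟨EuclideanSpace.single 1 1, by simp⟩), ?_⟩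
  simp [PhiRf, JR, Hf, hf0]

theorem isStem_PhiRf_fiber {R : ℝ} (hR : R ≠ 0) {f : ℝ × ℝ → ℝ}
    (hf : ContDiffOn ℝ ∞ f (Icc (-1) 1 ×ˢ Icc (-1) 1))
    (hF : ∀ z ∈ Icc (-1 : ℝ) 1, R * z ∈ Icc (-1 : ℝ) 1 → FRf R f z = 0) :
    IsStem (omegaR R) (PhiRf R f ⁻¹' {(0, 0)}) := by
  refine ⟨isClosed_singleton.preimage (contMDiff_PhiRf R hf).continuous, ?_⟩
  let J' : C^∞⟮(𝓡 2).prod (𝓡 2), S2 × S2; ℝ⟯ := ⟨JR R, contMDiff_JR R⟩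
  let H' : C^∞⟮(𝓡 2).prod (𝓡 2), S2 × S2; ℝ⟯ := ⟨Hf f, contMDiff_Hf hf⟩
  -- The moment map of this span has the same fibers as `PhiRf R f`, since a functional on it is
  -- determined by its values on `J'` and `H'`.
  let A : Submodule ℝ C^∞⟮(𝓡 2).prod (𝓡 2), S2 × S2; ℝ⟯ := Submodule.span ℝ {J', H'}
  have hA : ∀ F ∈ A, ∃ a b : ℝ, ⇑F = (fun y : ℝ × ℝ => a * y.1 + b * y.2) ∘ PhiRf R f :=
    fun F hF => by
      obtain ⟨a, b, rfl⟩ := Submodule.mem_span_pair.mp hF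
      exact ⟨a, b, rfl⟩
  have hu : ∀ a b : ℝ, ContDiff ℝ ∞ (fun y : ℝ × ℝ => a * y.1 + b * y.2) := fun a b => by
    fun_prop
  have hfib : ∀ x y, momentMap A x = momentMap A y ↔ PhiRf R f x = PhiRf R f y := fun x y => by
    constructor
    · intro h
      have hJ := DFunLike.congr_fun h (⟨J', Submodule.subset_span (by simp)⟩ : A)
      have hH := DFunLike.congr_fun h (⟨H', Submodule.subset_span (by simp)⟩ : A)
      exact Prod.ext hJ hH
    · intro h
      refine LinearMap.ext fun F => ?_
      obtain ⟨a, b, hab⟩ := hA F F.2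
      change (F : C^∞⟮(𝓡 2).prod (𝓡 2), S2 × S2; ℝ⟯) x =
        (F : C^∞⟮(𝓡 2).prod (𝓡 2), S2 × S2; ℝ⟯) y
      rw [hab, Function.comp_apply, Function.comp_apply, h]
  have hpre : ∀ x, momentMap A ⁻¹' {momentMap A x} = PhiRf R f ⁻¹' {PhiRf R f x} := fun x =>
    Set.ext fun y => hfib y x
  obtain ⟨x₀, hx₀⟩ := PhiRf_fiber_nonempty (R := R) (f := f)
    (hF 0 (by simp) (by simp))
  have hx₀ : PhiRf R f x₀ = (0, 0) := hx₀
  refine ⟨A, FiniteDimensional.span_of_finite ℝ (by simp), ?_, momentMap A x₀, ⟨x₀, rfl⟩, ?_, ?_⟩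
  · intro F hFA G hGA x
    obtain ⟨a, b, hab⟩ := hA F hFA
    obtain ⟨a', b', hab'⟩ := hA G hGA
    rw [hab, hab']
    exact poissonBracket_comp_PhiRf hR hf (hu a b) (hu a' b') x
  · rw [hpre, hx₀]
  · rintro _ ⟨x, rfl⟩ hne
    rw [hpre] at hne ⊢
    exact displaceable_PhiRf_fiber hR hf hF _ fun h => hne (by rw [h])

end Fibers

end SymplecticQuasiState

end

theorem mainTheorem9 (R : ℝ) (hR : 0 < R) (f : ℝ × ℝ → ℝ)
    (hf : ContDiffOn ℝ ∞ f (Set.Icc (-1) 1 ×ˢ Set.Icc (-1) 1))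
    (hF : ∀ z ∈ Set.Icc (-1 : ℝ) 1, R * z ∈ Set.Icc (-1 : ℝ) 1 →
      SymplecticQuasiState.FRf R f z = 0) :
    SymplecticQuasiState.IsStem (SymplecticQuasiState.omegaR R)
      (SymplecticQuasiState.PhiRf R f ⁻¹' {(0, 0)}) ∧
    ∀ ζ : C(SymplecticQuasiState.S2 × SymplecticQuasiState.S2, ℝ) → ℝ,
      SymplecticQuasiState.IsPartialSymplecticQuasiState (SymplecticQuasiState.omegaR R) ζ →
      SymplecticQuasiState.IsSuperheavy ζ (SymplecticQuasiState.PhiRf R f ⁻¹' {(0, 0)}) :=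
  ⟨SymplecticQuasiState.isStem_PhiRf_fiber hR.ne' hf hF, fun _ hζ =>
    hζ.isSuperheavy_fiber (SymplecticQuasiState.contMDiff_PhiRf R hf)
      (fun _ _ hu hv => SymplecticQuasiState.poissonBracket_comp_PhiRf hR.ne' hf hu hv)
      (SymplecticQuasiState.displaceable_PhiRf_fiber hR.ne' hf hF)⟩
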